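/- Let $A\in\mathbb{R}^{n\times n}$, $B\in\mathbb{R}^{n\times m}$, and consider the linear system with noisy state measurements $$x_{k+1}=Ax_k+Bu_k+w_k,\qquad y_k=x_k+v_k,\qquad k\ge 0,$$ where $w_k\sim\mathcal N(0,\Sigma_w)$ and $v_k\sim\mathcal N(0,\Sigma_v)$ with $\Sigma_w,\Sigma_v\succeq 0$, and all the random vectors $w_0,w_1,\dots,v_0,v_1,\dots$ are mutually independent. Let $H_k\in\mathbb{R}^{p\times n}$ and $h_k\in\mathbb{R}^p$; the state $x_k$ is called safe if $H_kx_k\le h_k$ componentwise. For $t\ge 2$ put $N=\lfloor t/2\rfloor$ and $$\widehat\Sigma_w=\frac1N\sum_{k=0}^{N-1}(y_{2k+1}-\widehat y_{2k+1})(y_{2k+1}-\widehat y_{2k+1})^\top,\qquad \widehat y_{2k+1}=Ay_{2k}+Bu_{2k}.$$ Let $\delta>0$, let $t>2n+3$ (so that $N-n-1\geq 1$), let $\bar u_t\in\mathbb{R}^m$ be a (possibly random) nominal input, let $\mathbf d:\mathbb{R}^m\times\mathbb{R}^m\to\mathbb{R}$ be a function measuring distance, and consider the robust program $$\min_{u\in\mathbb{R}^m}\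 \mathbf d(u,\bar u_t)\quad\text{s.t.}\quad H_{t+1}(Ay_t+Bu+\check w)\le h_{t+1}\quad\text{for all }\check w\in\mathbb{R}^n\text{ with }\ \check w^\top\widehat\Sigma_w^{-1}\check w\le\frac{Nn}{(N-n-1)\,\delta},$$ where, if $\widehat\Sigma_w$ is singular, the constraint is imposed for all $\check w\in\mathbb{R}^n$. Suppose that, almost surely, whenever this program is feasible, the implemented input $u_t$ is a minimizer of it. Then: 1. if the program is feasible almost surely, then $\mathbb{P}\{H_{t+1}x_{t+1}\le h_{t+1}\}\ge 1-\delta$; 2. without assuming feasibility, the probability that the program is infeasible or $x_{t+1}$ is safe is at least $1-\delta$. -/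

import Mathlib

open scoped Matrix

namespace NoisySafeLearning

noncomputable section

/-- Empirical covariance at time `t` along a trajectory of measurements `y` and inputs `u`, built
from every other sample:
`Σ̂ = (1 / ⌊t/2⌋) ∑_{k < ⌊t/2⌋} (y_{2k+1} - ŷ_{2k+1}) (y_{2k+1} - ŷ_{2k+1})ᵀ`,
where `ŷ_{2k+1} = A y_{2k} + B u_{2k}` (here `t / 2` is division in `ℕ`). -/
def empiricalCov {n m : ℕ} (A : Matrix (Fin n) (Fin n) ℝ) (B : Matrix (Fin n) (Fin m) ℝ)
    (y : ℕ → Fin n → ℝ) (u : ℕ → Fin m → ℝ) (t : ℕ) : Matrix (Fin n) (Fin n) ℝ :=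
  ((t / 2 : ℕ) : ℝ)⁻¹ • ∑ k ∈ Finset.range (t / 2),
    Matrix.vecMulVec
      (y (2 * k + 1) - (A *ᵥ y (2 * k) + B *ᵥ u (2 * k)))
      (y (2 * k + 1) - (A *ᵥ y (2 * k) + B *ᵥ u (2 * k)))

/-- The bound `⌊t/2⌋ n / ((⌊t/2⌋ - n - 1) δ)` in the uncertainty ellipsoid. -/
def ellipsoidBound (n t : ℕ) (δ : ℝ) : ℝ :=
  (((t / 2 : ℕ) : ℝ) * n) / ((((t / 2 : ℕ) : ℝ) - n - 1) * δ)

/-- Feasible set of the robust program: all inputs `u` such that `H (A y + B u + w) ≤ h`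
(componentwise) for every `w` with `wᵀ S⁻¹ w ≤ c`. If `S` is singular, `S⁻¹` is the zero matrix in
Mathlib, so that the constraint is then required for every `w` (when `0 ≤ c`). -/
def feasibleSet {n m p : ℕ} (A : Matrix (Fin n) (Fin n) ℝ) (B : Matrix (Fin n) (Fin m) ℝ)
    (H : Matrix (Fin p) (Fin n) ℝ) (h : Fin p → ℝ) (y : Fin n → ℝ)
    (S : Matrix (Fin n) (Fin n) ℝ) (c : ℝ) : Set (Fin m → ℝ) :=
  {u | ∀ w : Fin n → ℝ, w ⬝ᵥ (S⁻¹ *ᵥ w) ≤ c → H *ᵥ (A *ᵥ y + B *ᵥ u + w) ≤ h}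

/-- `u` is a minimizer of `d(·, ubar)` over the set `F`. -/
def IsArgmin {m : ℕ} (d : (Fin m → ℝ) → (Fin m → ℝ) → ℝ) (ubar : Fin m → ℝ)
    (F : Set (Fin m → ℝ)) (u : Fin m → ℝ) : Prop :=
  u ∈ F ∧ ∀ u' ∈ F, d u ubar ≤ d u' ubar

end

end NoisySafeLearning

/-! Put `e_k = w_{2k} + v_{2k+1} - A v_{2k}`, the residual of the one-step prediction, and `z = w_t
- A v_t`, so that `x_{t+1} = A y_t + B u_t + z`. Inputs cancel from both, so however `u` depends on
the past, a feasible input is safe as soon as `z` lies in the uncertainty ellipsoid. It remains to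
show that `z` leaves the ellipsoid with probability at most `δ`.

Using every other sample makes the noise indices of the `e_k` disjoint: they are i.i.d. centred
Gaussian with covariance `S = Sw + Sv + A Sv Aᵀ`. Also `z` is independent of them, with covariance
`S - Sv`, which is at most `S`. With `M = ∑ e_k e_kᵀ`, Markov's inequality reduces the claim to
`E[zᵀ M⁻¹ z] ≤ n / (N - n - 1)`, an inverse Wishart mean.

This is proved without densities, hence also for singular `S`. Let `R = (ε + M)⁻¹` and `q_k = e_kᵀ R
e_k`. Gaussian integration by parts gives `E ∑ q_k = E[tr(RS) (N - ∑ q_k) - tr(RMRS)]`. Since `∑ q_k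
= tr(RM) ≤ n` and `tr(RMRS) ≤ tr(RS)`, it follows that `(N - n - 1) E tr(RS) ≤ n`
(`integral_trace_resolvent_mul_le`). Independence and `Cov z ≤ S` give `E[zᵀ R z] ≤ E tr(RS)`, and
Fatou's lemma as `ε → 0` finishes (`lintegral_dotProduct_inv_scatter_le`). -/

namespace NoisySafeLearning

open MeasureTheory ProbabilityTheory Matrix

/-! ### Rank-one updates, quadratic forms and traces. -/

section QuadraticForms

variable {ι : Type*} [Fintype ι]

theorem posSemidef_vecMulVec_self (X : ι → ℝ) : (vecMulVec X X).PosSemidef := by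
  simpa using posSemidef_vecMulVec_self_star X

/-- The Sherman–Morrison formula for a symmetric rank-one perturbation. -/
theorem inv_add_vecMulVec_self [DecidableEq ι] {C : Matrix ι ι ℝ} (hC : C.PosDef) (X : ι → ℝ) :
    (C + vecMulVec X X)⁻¹ =
      C⁻¹ - (1 + X ⬝ᵥ C⁻¹ *ᵥ X)⁻¹ • vecMulVec (C⁻¹ *ᵥ X) (C⁻¹ *ᵥ X) := by
  have hq : 0 ≤ X ⬝ᵥ C⁻¹ *ᵥ X := by
    simpa using hC.inv.posSemidef.dotProduct_mulVec_nonneg X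
  have hdet : IsUnit C.det := (Matrix.isUnit_iff_isUnit_det C).1 hC.isUnit
  have hsymm : X ᵥ* C⁻¹ = C⁻¹ *ᵥ X := by
    rw [← mulVec_transpose]
    congr 1
    simpa using hC.inv.isHermitian.eq
  apply inv_eq_right_inv
  rw [Matrix.mul_sub, Matrix.add_mul, Matrix.mul_smul, Matrix.add_mul, mul_nonsing_inv _ hdet,
    vecMulVec_mul, hsymm,
    mul_vecMulVec, mulVec_mulVec, mul_nonsing_inv _ hdet, one_mulVec, vecMulVec_mul_vecMulVec]
  ext i j
  simp only [Matrix.add_apply, Matrix.sub_apply, Matrix.smul_apply, vecMulVec_apply, smul_eq_mul,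
    Pi.smul_apply]
  have : (1 + X ⬝ᵥ C⁻¹ *ᵥ X) ≠ 0 := by positivity
  field_simp
  ring

theorem dotProduct_inv_add_vecMulVec_self [DecidableEq ι] {C : Matrix ι ι ℝ} (hC : C.PosDef)
    (X a b : ι → ℝ) :
    a ⬝ᵥ (C + vecMulVec X X)⁻¹ *ᵥ b =
      a ⬝ᵥ C⁻¹ *ᵥ b - (a ⬝ᵥ C⁻¹ *ᵥ X) * (b ⬝ᵥ C⁻¹ *ᵥ X) / (1 + X ⬝ᵥ C⁻¹ *ᵥ X) := by
  rw [inv_add_vecMulVec_self hC, sub_mulVec, smul_mulVec, vecMulVec_mulVec]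
  simp [dotProduct_sub, dotProduct_smul, dotProduct_comm b]
  ring

theorem dotProduct_mulVec_comm_of_isHermitian {Q : Matrix ι ι ℝ} (hQ : Q.IsHermitian)
    (a b : ι → ℝ) : a ⬝ᵥ Q *ᵥ b = b ⬝ᵥ Q *ᵥ a := by
  have hT : Qᵀ = Q := by simpa using hQ.eq
  rw [dotProduct_mulVec, ← mulVec_transpose, hT, dotProduct_comm]

theorem two_mul_abs_dotProduct_mulVec_le {Q : Matrix ι ι ℝ} (hQ : Q.PosSemidef) (a b : ι → ℝ) :
    2 * |a ⬝ᵥ Q *ᵥ b| ≤ a ⬝ᵥ Q *ᵥ a + b ⬝ᵥ Q *ᵥ b := by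
  have h1 : 0 ≤ (a + b) ⬝ᵥ Q *ᵥ (a + b) := by simpa using hQ.dotProduct_mulVec_nonneg (a + b)
  have h2 : 0 ≤ (a - b) ⬝ᵥ Q *ᵥ (a - b) := by simpa using hQ.dotProduct_mulVec_nonneg (a - b)
  have hs := dotProduct_mulVec_comm_of_isHermitian hQ.isHermitian a b
  simp only [mulVec_add, mulVec_sub, add_dotProduct, sub_dotProduct, dotProduct_add,
    dotProduct_sub] at h1 h2
  rcases abs_cases (a ⬝ᵥ Q *ᵥ b) with ⟨h, _⟩ | ⟨h, _⟩ <;> rw [h] <;> linarith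

theorem posDef_smul_one_add {ι : Type*} [DecidableEq ι] {ε : ℝ} (hε : 0 < ε) {M : Matrix ι ι ℝ}
    (hM : M.PosSemidef) :
    (ε • (1 : Matrix ι ι ℝ) + M).PosDef :=
  (PosDef.one.smul hε).add_posSemidef hM

/-- With `b = Q a`, the identity `a = ε b + M b` gives `ε |b|² ≤ a ⬝ b`; combine this with `|a - ε
b|² ≥ 0`. -/
theorem dotProduct_resolvent_le [DecidableEq ι] {ε : ℝ} (hε : 0 < ε) {M : Matrix ι ι ℝ}
    (hM : M.PosSemidef)
    (a : ι → ℝ) : a ⬝ᵥ (ε • (1 : Matrix ι ι ℝ) + M)⁻¹ *ᵥ a ≤ ε⁻¹ * (a ⬝ᵥ a) := by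
  have hP := posDef_smul_one_add hε hM
  set Q := (ε • (1 : Matrix ι ι ℝ) + M)⁻¹ with hQ
  set b := Q *ᵥ a with hb
  have hab : ε • b + M *ᵥ b = a := by
    have : (ε • (1 : Matrix ι ι ℝ) + M) *ᵥ b = a := by
      rw [hb, mulVec_mulVec, hQ, mul_nonsing_inv _ ((Matrix.isUnit_iff_isUnit_det _).1 hP.isUnit),
        one_mulVec]
    rwa [add_mulVec, smul_mulVec, one_mulVec] at this
  have hMb : 0 ≤ b ⬝ᵥ M *ᵥ b := by simpa using hM.dotProduct_mulVec_nonneg b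
  have h1 : ε * (b ⬝ᵥ b) ≤ a ⬝ᵥ b := by
    calc ε * (b ⬝ᵥ b) ≤ ε * (b ⬝ᵥ b) + b ⬝ᵥ M *ᵥ b := by linarith
      _ = b ⬝ᵥ (ε • b + M *ᵥ b) := by rw [dotProduct_add, dotProduct_smul, smul_eq_mul]
      _ = a ⬝ᵥ b := by rw [hab, dotProduct_comm]
  have h2 : 0 ≤ (a - ε • b) ⬝ᵥ (a - ε • b) := by
    simpa using dotProduct_star_self_nonneg (a - ε • b)
  simp only [sub_dotProduct, dotProduct_sub, dotProduct_smul, smul_dotProduct, smul_eq_mul,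
    dotProduct_comm b a] at h2
  rw [← div_eq_inv_mul, le_div_iff₀ hε]
  nlinarith

theorem sum_dotProduct_mulVec_col {κ : Type*} [Fintype κ] (L : Matrix ι κ ℝ) (Q : Matrix ι ι ℝ) :
    ∑ c, L.col c ⬝ᵥ Q *ᵥ L.col c = (Q * (L * Lᵀ)).trace := by
  rw [← Matrix.mul_assoc, trace_mul_comm, ← Matrix.mul_assoc]
  simp only [trace, diag_apply, mul_apply, transpose_apply, dotProduct, mulVec, col_apply]
  refine Finset.sum_congr rfl fun c _ => ?_
  simp only [Finset.sum_mul, Finset.mul_sum]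
  rw [Finset.sum_comm]
  exact Finset.sum_congr rfl fun i _ => Finset.sum_congr rfl fun j _ => by ring

theorem dotProduct_mulVec_eq_trace (Q : Matrix ι ι ℝ) (a b : ι → ℝ) :
    a ⬝ᵥ Q *ᵥ b = (Q * vecMulVec b a).trace := by
  rw [mul_vecMulVec, trace_vecMulVec, dotProduct_comm]

theorem trace_mul_nonneg {Q S : Matrix ι ι ℝ} (hQ : Q.PosSemidef) (hS : S.PosSemidef) :
    0 ≤ (Q * S).trace := by
  obtain ⟨r, v, rfl⟩ := posSemidef_iff_eq_sum_vecMulVec.1 hS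
  rw [Matrix.mul_sum, trace_sum]
  refine Finset.sum_nonneg fun i _ => ?_
  rw [← dotProduct_mulVec_eq_trace]
  exact hQ.dotProduct_mulVec_nonneg (v i)

end QuadraticForms

/-! ### Stein's identity on the line and in one coordinate of a product. -/

section Gaussian

/-- Gaussian integration by parts on the real line. -/
theorem integral_mul_gaussianReal_eq_integral_deriv {f f' : ℝ → ℝ}
    (hf : ∀ s, HasDerivAt f (f' s) s) (hi : Integrable f (gaussianReal 0 1))
    (hxi : Integrable (fun s => s * f s) (gaussianReal 0 1))
    (hi' : Integrable f' (gaussianReal 0 1)) :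
    ∫ s, s * f s ∂(gaussianReal 0 1) = ∫ s, f' s ∂(gaussianReal 0 1) := by
  have key : ∀ g : ℝ → ℝ, Integrable g (gaussianReal 0 1) →
      Integrable (fun s => g s * gaussianPDFReal 0 1 s) := by
    intro g hg
    rw [gaussianReal_of_var_ne_zero _ one_ne_zero,
      integrable_withDensity_iff (measurable_gaussianPDF 0 1) (by simp [gaussianPDF])] at hg
    simpa [gaussianPDF, gaussianPDFReal_nonneg] using hg
  -- The standard Gaussian density satisfies `φ' = -s φ`, which turns the factor `s` into a
  -- derivative.
  have hpdf : ∀ s, HasDerivAt (gaussianPDFReal 0 1) (-s * gaussianPDFReal 0 1 s) s := by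
    intro s
    have h1 : HasDerivAt (fun s : ℝ => -(s - 0) ^ 2 / (2 * ((1 : NNReal) : ℝ))) (-s) s := by
      have := (((hasDerivAt_id s).sub_const 0).pow 2).neg.div_const (2 * ((1 : NNReal) : ℝ))
      convert! this using 1
      simp only [NNReal.coe_one, id_eq, sub_zero, Nat.cast_ofNat]
      ring
    have h2 := h1.exp.const_mul ((Real.sqrt (2 * Real.pi * ((1 : NNReal) : ℝ)))⁻¹)
    rw [gaussianPDFReal_def]
    convert! h2 using 1
    ring
  have := integral_mul_deriv_eq_deriv_mul_of_integrable (u := f) (v := gaussianPDFReal 0 1)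
    (u' := f') (v' := fun s => -s * gaussianPDFReal 0 1 s) (fun s _ => hf s) (fun s _ => hpdf s)
    (by
      refine (key _ hxi).neg.congr (ae_of_all _ fun s => ?_)
      simp only [Pi.neg_apply, Pi.mul_apply]
      ring) (key _ hi') (key _ hi)
  rw [integral_gaussianReal_eq_integral_smul one_ne_zero,
    integral_gaussianReal_eq_integral_smul one_ne_zero]
  simp only [smul_eq_mul]
  have h3 : ∫ s, f s * (-s * gaussianPDFReal 0 1 s) =
      -∫ s, gaussianPDFReal 0 1 s * (s * f s) := by
    rw [← integral_neg]
    congr with s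
    ring
  rw [h3, neg_inj] at this
  rw [this]
  congr with s
  ring

theorem integrable_pow_gaussianReal (k : ℕ) :
    Integrable (fun s : ℝ => s ^ k) (gaussianReal 0 1) := by
  rcases Nat.eq_zero_or_pos k with rfl | hk
  · simp
  · have := (memLp_id_gaussianReal' (μ := 0) (v := 1) (k : ENNReal) (by simp)).integrable_norm_pow
      (by omega)
    rw [← integrable_norm_iff (by fun_prop)]
    simpa using this

theorem integral_mul_affine_gaussianReal (a b : ℝ) :
    ∫ s, s * (a + s * b) ∂(gaussianReal 0 1) = b := by
  have h1 := integrable_pow_gaussianReal 1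
  have h2 := integrable_pow_gaussianReal 2
  simp only [pow_one] at h1
  rw [integral_mul_gaussianReal_eq_integral_deriv (f' := fun _ => b)]
  · simp
  · intro s
    simpa using ((hasDerivAt_id s).mul_const b).const_add a
  · exact (integrable_const a).add (h1.mul_const b)
  · refine ((h1.mul_const a).add (h2.mul_const b)).congr (ae_of_all _ fun s => ?_)
    simp only [Pi.add_apply]
    ring
  · exact integrable_const b

/-- Along one coordinate, Sherman–Morrison turns `lᵀ R e` into this rational function, its
denominator being `1` plus the quadratic form of `e`. Nonnegativity of that form keeps the
denominator at least `1`, whence all the integrability. -/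
theorem integral_mul_rational_gaussianReal {α β γ : ℝ}
    (hq : ∀ s, 0 ≤ α + 2 * β * s + γ * s ^ 2) :
    ∫ s, s * ((β + γ * s) / (1 + (α + 2 * β * s + γ * s ^ 2))) ∂(gaussianReal 0 1) =
      ∫ s, (γ / (1 + (α + 2 * β * s + γ * s ^ 2)) -
        2 * (β + γ * s) ^ 2 / (1 + (α + 2 * β * s + γ * s ^ 2)) ^ 2) ∂(gaussianReal 0 1) := by
  have h1 := integrable_pow_gaussianReal 1
  have h2 := integrable_pow_gaussianReal 2
  simp only [pow_one] at h1
  have hden : ∀ s, 1 ≤ 1 + (α + 2 * β * s + γ * s ^ 2) := fun s => by linarith [hq s]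
  have hdiv : ∀ (r s : ℝ), |r / (1 + (α + 2 * β * s + γ * s ^ 2))| ≤ |r| := fun r s => by
    rw [abs_div, abs_of_pos (lt_of_lt_of_le one_pos (hden s))]
    exact div_le_self (abs_nonneg r) (hden s)
  have hlin : Integrable (fun s : ℝ => β + γ * s) (gaussianReal 0 1) :=
    (integrable_const β).add (h1.const_mul γ)
  have hlin1 : Integrable (fun s : ℝ => s * (β + γ * s)) (gaussianReal 0 1) :=
    ((h1.const_mul β).add (h2.const_mul γ)).congr (ae_of_all _ fun s => by
      simp only [Pi.add_apply]; ring)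
  have hlin2 : Integrable (fun s : ℝ => 2 * (β + γ * s) ^ 2) (gaussianReal 0 1) :=
    (((integrable_const (2 * β ^ 2)).add (h1.const_mul (4 * β * γ))).add
      (h2.const_mul (2 * γ ^ 2))).congr (ae_of_all _ fun s => by
      simp only [Pi.add_apply]; ring)
  refine integral_mul_gaussianReal_eq_integral_deriv (fun s => ?_) ?_ ?_ ?_
  · have hn : HasDerivAt (fun s : ℝ => β + γ * s) γ s := by
      simpa using ((hasDerivAt_id s).const_mul γ).const_add β
    have hd : HasDerivAt (fun s : ℝ => 1 + (α + 2 * β * s + γ * s ^ 2))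
        (2 * β + γ * (2 * s)) s := by
      have h3 := (((hasDerivAt_id s).const_mul (2 * β)).const_add α).add
        (((hasDerivAt_id s).pow 2).const_mul γ)
      simpa using h3.const_add 1
    have hne : 1 + (α + 2 * β * s + γ * s ^ 2) ≠ 0 := by linarith [hden s]
    convert! hn.div hd hne using 1
    field_simp
  · exact hlin.mono (Measurable.aestronglyMeasurable (by fun_prop)) (ae_of_all _ fun s => hdiv _ s)
  · refine hlin1.mono (Measurable.aestronglyMeasurable (by fun_prop)) (ae_of_all _ fun s => ?_)
    rw [← mul_div_assoc]
    exact hdiv _ s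
  · refine Integrable.sub ?_ ?_
    · exact (integrable_const γ).mono (Measurable.aestronglyMeasurable (by fun_prop))
        (ae_of_all _ fun s => hdiv _ s)
    · refine hlin2.mono (Measurable.aestronglyMeasurable (by fun_prop)) (ae_of_all _ fun s => ?_)
      rw [pow_two (1 + _), ← div_div]
      exact (hdiv _ s).trans (hdiv _ s)

variable {J : Type*} [Fintype J] [DecidableEq J]

/-- Resampling one coordinate independently preserves the product law; this gives Fubini in that
coordinate without splitting the index type. -/
theorem measurePreserving_update (μ : Measure ℝ) [IsProbabilityMeasure μ] (c : J) :
    MeasurePreserving (fun z : (J → ℝ) × ℝ => Function.update z.1 c z.2)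
      ((Measure.pi fun _ => μ).prod μ) (Measure.pi fun _ => μ) := by
  have hm : Measurable (fun z : (J → ℝ) × ℝ => Function.update z.1 c z.2) := by
    refine measurable_pi_lambda _ fun j => ?_
    by_cases hj : j = c
    · subst hj; simpa using measurable_snd
    · simp only [Function.update_of_ne hj]; fun_prop
  refine ⟨hm, (Measure.pi_eq fun s hs => ?_).symm⟩
  rw [Measure.map_apply hm (MeasurableSet.univ_pi hs)]
  have : (fun z : (J → ℝ) × ℝ => Function.update z.1 c z.2) ⁻¹' Set.pi Set.univ s =
      (Set.pi Set.univ (Function.update s c Set.univ)) ×ˢ s c := by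
    ext z
    simp only [Set.mem_preimage, Set.mem_pi, Set.mem_univ, true_implies, Set.mem_prod]
    constructor
    · refine fun h => ⟨fun j => ?_, by simpa using h c⟩
      by_cases hj : j = c
      · subst hj; simp
      · simpa [hj] using h j
    · rintro ⟨h, h'⟩ j
      by_cases hj : j = c
      · subst hj; simpa using h'
      · simpa [hj] using h j
  rw [this, Measure.prod_prod, Measure.pi_pi, ← Finset.prod_erase_mul _ _ (Finset.mem_univ c),
    ← Finset.prod_erase_mul _ _ (Finset.mem_univ c)]
  simp only [Function.update_self, measure_univ, mul_one]
  congr 1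
  exact Finset.prod_congr rfl fun j hj => by rw [Function.update_of_ne (Finset.ne_of_mem_erase hj)]

theorem integral_coord_mul_eq {μ : Measure ℝ} [IsProbabilityMeasure μ] (c : J)
    {F F' : (J → ℝ) → ℝ}
    (hF : Integrable (fun x => x c * F x) (Measure.pi fun _ => μ))
    (hF' : Integrable F' (Measure.pi fun _ => μ))
    (h : ∀ x, ∫ s, s * F (Function.update x c s) ∂μ = ∫ s, F' (Function.update x c s) ∂μ) :
    ∫ x, x c * F x ∂(Measure.pi fun _ => μ) = ∫ x, F' x ∂(Measure.pi fun _ => μ) := by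
  have hu := measurePreserving_update (J := J) μ c
  have key : ∀ G : (J → ℝ) → ℝ, Integrable G (Measure.pi fun _ => μ) →
      ∫ x, G x ∂(Measure.pi fun _ => μ) =
        ∫ x, ∫ s, G (Function.update x c s) ∂μ ∂(Measure.pi fun _ => μ) := by
    intro G hG
    rw [← hu.map_eq, integral_map hu.measurable.aemeasurable
      (by rw [hu.map_eq]; exact hG.aestronglyMeasurable)]
    rw [hu.map_eq]
    exact integral_prod _ (hu.integrable_comp_of_integrable hG)
  rw [key _ hF, key _ hF']
  simp only [Function.update_self, h]

end Gaussian

/-! ### Scatter matrices and deterministic bounds on their resolvents. -/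

section Scatter

variable {ι J K : Type*} [Fintype J] [Fintype K]

/-- The scatter matrix `∑ₖ eₖ eₖᵀ` of the vectors `eₖ = Eₖ x`. -/
noncomputable def scatter (E : K → Matrix ι J ℝ) (x : J → ℝ) : Matrix ι ι ℝ :=
  ∑ k, vecMulVec (E k *ᵥ x) (E k *ᵥ x)

theorem continuous_scatter (E : K → Matrix ι J ℝ) : Continuous (scatter E) :=
  continuous_finsetSum _ fun k _ =>
    Continuous.matrix_vecMulVec (by fun_prop) (by fun_prop)

theorem posSemidef_scatter [Finite ι] (E : K → Matrix ι J ℝ) (x : J → ℝ) :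
    (scatter E x).PosSemidef := by
  have := Fintype.ofFinite ι
  exact posSemidef_sum _ fun k _ => posSemidef_vecMulVec_self _

variable [DecidableEq ι]

/-- The regularised inverse `(ε + ∑ₖ eₖ eₖᵀ)⁻¹` of the scatter matrix. -/
noncomputable def resolvent [Fintype ι] (ε : ℝ) (E : K → Matrix ι J ℝ) (x : J → ℝ) :
    Matrix ι ι ℝ :=
  (ε • (1 : Matrix ι ι ℝ) + scatter E x)⁻¹

variable [Fintype ι]

/-- Writing the inverse as `det⁻¹ • adjugate` covers singular matrices too, where both sides vanish.
-/
theorem measurable_dotProduct_inv_mulVec {α : Type*} [TopologicalSpace α] [MeasurableSpace α]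
    [OpensMeasurableSpace α] {M : α → Matrix ι ι ℝ} (hM : Continuous M) {a b : α → ι → ℝ}
    (ha : Continuous a) (hb : Continuous b) :
    Measurable fun x => a x ⬝ᵥ (M x)⁻¹ *ᵥ b x := by
  have : (fun x => a x ⬝ᵥ (M x)⁻¹ *ᵥ b x) =
      fun x => ((M x).det)⁻¹ * (a x ⬝ᵥ (M x).adjugate *ᵥ b x) := by
    ext x
    rw [inv_def, Ring.inverse_eq_inv', smul_mulVec, dotProduct_smul, smul_eq_mul]
  rw [this]
  exact hM.matrix_det.measurable.inv.mul
    (ha.dotProduct (hM.matrix_adjugate.matrix_mulVec hb)).measurable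

theorem measurable_dotProduct_resolvent (ε : ℝ) (E : K → Matrix ι J ℝ)
    {a b : (J → ℝ) → ι → ℝ} (ha : Continuous a) (hb : Continuous b) :
    Measurable fun x => a x ⬝ᵥ resolvent ε E x *ᵥ b x :=
  measurable_dotProduct_inv_mulVec (continuous_const.add (continuous_scatter E)) ha hb

theorem posDef_resolvent {ε : ℝ} (hε : 0 < ε) (E : K → Matrix ι J ℝ) (x : J → ℝ) :
    (resolvent ε E x).PosDef :=
  (posDef_smul_one_add hε (posSemidef_scatter E x)).inv

theorem dotProduct_resolvent_nonneg {ε : ℝ} (hε : 0 < ε) (E : K → Matrix ι J ℝ) (x : J → ℝ)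
    (a : ι → ℝ) : 0 ≤ a ⬝ᵥ resolvent ε E x *ᵥ a := by
  simpa using (posDef_resolvent hε E x).posSemidef.dotProduct_mulVec_nonneg a

theorem resolvent_mul_scatter {ε : ℝ} (hε : 0 < ε) (E : K → Matrix ι J ℝ) (x : J → ℝ) :
    resolvent ε E x * scatter E x = 1 - ε • resolvent ε E x := by
  have hP := posDef_smul_one_add hε (posSemidef_scatter E x)
  have h : resolvent ε E x * (ε • (1 : Matrix ι ι ℝ) + scatter E x) = 1 :=
    nonsing_inv_mul _ ((Matrix.isUnit_iff_isUnit_det _).1 hP.isUnit)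
  rw [Matrix.mul_add, Matrix.mul_smul, Matrix.mul_one] at h
  rw [← h, add_sub_cancel_left]

/-- The sum is `tr(RM) = n - ε tr R`. -/
theorem sum_dotProduct_resolvent_le_card {ε : ℝ} (hε : 0 < ε) (E : K → Matrix ι J ℝ)
    (x : J → ℝ) :
    ∑ k, E k *ᵥ x ⬝ᵥ resolvent ε E x *ᵥ (E k *ᵥ x) ≤ Fintype.card ι := by
  simp only [dotProduct_mulVec_eq_trace]
  rw [← trace_sum, ← Matrix.mul_sum]
  change (resolvent ε E x * scatter E x).trace ≤ _
  rw [resolvent_mul_scatter hε, trace_sub, trace_one, trace_smul, smul_eq_mul]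
  have := (posDef_resolvent hε E x).posSemidef.trace_nonneg
  nlinarith

theorem dotProduct_resolvent_self_le_card {ε : ℝ} (hε : 0 < ε) (E : K → Matrix ι J ℝ)
    (x : J → ℝ) (k : K) :
    E k *ᵥ x ⬝ᵥ resolvent ε E x *ᵥ (E k *ᵥ x) ≤ Fintype.card ι :=
  (Finset.single_le_sum (f := fun k => E k *ᵥ x ⬝ᵥ resolvent ε E x *ᵥ (E k *ᵥ x))
    (fun _ _ => dotProduct_resolvent_nonneg hε E x _) (Finset.mem_univ k)).trans
    (sum_dotProduct_resolvent_le_card hε E x)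

/-- The sum is `tr(RMRS) = tr(RS) - ε tr(R²S)`, and the last trace is nonnegative. -/
theorem sum_sq_dotProduct_resolvent_le {ε : ℝ} (hε : 0 < ε) (E : K → Matrix ι J ℝ)
    {S : Matrix ι ι ℝ} (hS : ∀ k, E k * (E k)ᵀ = S) (hpos : S.PosSemidef) (x : J → ℝ) :
    ∑ k, ∑ c, ((E k).col c ⬝ᵥ resolvent ε E x *ᵥ (E k *ᵥ x)) ^ 2 ≤
      (resolvent ε E x * S).trace := by
  set R := resolvent ε E x with hR
  have hRT : Rᵀ = R := by simpa using (posDef_resolvent hε E x).isHermitian.eq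
  have h1 : ∀ k, ∑ c, ((E k).col c ⬝ᵥ R *ᵥ (E k *ᵥ x)) ^ 2 =
      (R * vecMulVec (E k *ᵥ x) (E k *ᵥ x) * R * S).trace := by
    intro k
    have h2 : R * vecMulVec (E k *ᵥ x) (E k *ᵥ x) * R =
        vecMulVec (R *ᵥ (E k *ᵥ x)) (R *ᵥ (E k *ᵥ x)) := by
      rw [mul_vecMulVec, vecMulVec_mul]
      congr 1
      rw [← mulVec_transpose, hRT]
    rw [h2, ← hS k, ← sum_dotProduct_mulVec_col]
    refine Finset.sum_congr rfl fun c _ => ?_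
    rw [vecMulVec_mulVec]
    rw [dotProduct_smul, dotProduct_comm (R *ᵥ (E k *ᵥ x)), pow_two]
    rfl
  simp only [h1]
  rw [← trace_sum, ← Matrix.sum_mul, ← Matrix.sum_mul, ← Matrix.mul_sum]
  change (R * scatter E x * R * S).trace ≤ _
  rw [hR, resolvent_mul_scatter hε, ← hR, Matrix.sub_mul, Matrix.one_mul, Matrix.sub_mul,
    trace_sub, Matrix.smul_mul, Matrix.smul_mul, trace_smul, smul_eq_mul]
  have h3 : (R * R).PosSemidef := by
    have := posSemidef_conjTranspose_mul_self R
    rwa [conjTranspose_eq_transpose_of_trivial, hRT] at this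
  nlinarith [trace_mul_nonneg h3 hpos]

end Scatter

/-! ### Integration by parts for the resolvent, one Gaussian coordinate at a time. -/

section IntegrationByParts

theorem mulVec_eq_sum_smul_col {ι J : Type*} [Fintype J] (L : Matrix ι J ℝ) (x : J → ℝ) :
    L *ᵥ x = ∑ c, x c • L.col c := by
  ext i
  simp [mulVec, dotProduct, Finset.sum_apply, mul_comm]

theorem mulVec_update_eq {ι J : Type*} [Fintype J] [DecidableEq J] (L : Matrix ι J ℝ)
    (x : J → ℝ) (c : J) (s : ℝ) :
    L *ᵥ Function.update x c s = L *ᵥ Function.update x c 0 + s • L.col c := by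
  have : Function.update x c s = Function.update x c 0 + s • Pi.single c 1 := by
    ext j
    by_cases hj : j = c
    · subst hj; simp
    · simp [hj]
  rw [this, mulVec_add, mulVec_smul, mulVec_single_one]

theorem mulVec_update_of_col_eq_zero {ι J : Type*} [Fintype J] [DecidableEq J]
    (L : Matrix ι J ℝ) (x : J → ℝ) {c : J}
    (hc : L.col c = 0) (s : ℝ) : L *ᵥ Function.update x c s = L *ᵥ Function.update x c 0 := by
  rw [mulVec_update_eq, hc, smul_zero, add_zero]

theorem integrable_of_measurable_of_abs_le {α : Type*} [MeasurableSpace α] {μ : Measure α}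
    [IsFiniteMeasure μ] {f : α → ℝ} (hf : Measurable f) (C : ℝ) (h : ∀ x, |f x| ≤ C) :
    Integrable f μ :=
  Integrable.of_bound hf.aestronglyMeasurable C (ae_of_all _ h)

variable {ι J K : Type*} [Fintype ι] [DecidableEq ι] [Fintype J] [Fintype K]

/-- Bounds uniform in `x` are what the regularisation `ε` buys: integrability before `M` is known to
be invertible. -/
theorem abs_dotProduct_resolvent_le {ε : ℝ} (hε : 0 < ε) (E : K → Matrix ι J ℝ) (x : J → ℝ)
    (a b : ι → ℝ) :
    |a ⬝ᵥ resolvent ε E x *ᵥ b| ≤ ε⁻¹ * (a ⬝ᵥ a) + ε⁻¹ * (b ⬝ᵥ b) := by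
  have h := two_mul_abs_dotProduct_mulVec_le (posDef_resolvent hε E x).posSemidef a b
  have ha := dotProduct_resolvent_le hε (posSemidef_scatter E x) a
  have hb := dotProduct_resolvent_le hε (posSemidef_scatter E x) b
  have h0 := abs_nonneg (a ⬝ᵥ resolvent ε E x *ᵥ b)
  simp only [resolvent] at h h0 ⊢
  linarith

theorem abs_dotProduct_resolvent_mulVec_le {ε : ℝ} (hε : 0 < ε) (E : K → Matrix ι J ℝ)
    (x : J → ℝ) (k : K) (a : ι → ℝ) :
    |a ⬝ᵥ resolvent ε E x *ᵥ (E k *ᵥ x)| ≤ ε⁻¹ * (a ⬝ᵥ a) + Fintype.card ι := by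
  have h := two_mul_abs_dotProduct_mulVec_le (posDef_resolvent hε E x).posSemidef a (E k *ᵥ x)
  have ha := dotProduct_resolvent_le hε (posSemidef_scatter E x) a
  have hb := dotProduct_resolvent_self_le_card hε E x k
  have h0 := abs_nonneg (a ⬝ᵥ resolvent ε E x *ᵥ (E k *ᵥ x))
  simp only [resolvent] at h h0 hb ⊢
  linarith

theorem integrable_coord (c : J) :
    Integrable (fun x : J → ℝ => x c) (Measure.pi fun _ => gaussianReal 0 1) := by
  have h1 := integrable_pow_gaussianReal 1
  simp only [pow_one] at h1
  exact (measurePreserving_eval (fun _ : J => gaussianReal 0 1) c).integrable_comp_of_integrable h1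

theorem integrable_coord_mul_coord (c c' : J) :
    Integrable (fun x : J → ℝ => x c * x c') (Measure.pi fun _ => gaussianReal 0 1) := by
  have h (c : J) : MemLp (fun x : J → ℝ => x c) 2 (Measure.pi fun _ => gaussianReal 0 1) :=
    (memLp_id_gaussianReal' 2 (by simp)).comp_measurePreserving
      (measurePreserving_eval (fun _ : J => gaussianReal 0 1) c)
  exact (h c).integrable_mul (h c')

theorem integrable_dotProduct_resolvent {ε : ℝ} (hε : 0 < ε) (E : K → Matrix ι J ℝ) (a b : ι → ℝ) :
    Integrable (fun x => a ⬝ᵥ resolvent ε E x *ᵥ b) (Measure.pi fun _ => gaussianReal 0 1) :=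
  integrable_of_measurable_of_abs_le
    (measurable_dotProduct_resolvent ε E continuous_const continuous_const) _
    fun x => abs_dotProduct_resolvent_le hε E x a b

theorem integrable_coord_mul_dotProduct_resolvent {ε : ℝ} (hε : 0 < ε) (E : K → Matrix ι J ℝ)
    (k : K) (c : J) (a : ι → ℝ) :
    Integrable (fun x => x c * (a ⬝ᵥ resolvent ε E x *ᵥ (E k *ᵥ x)))
      (Measure.pi fun _ => gaussianReal 0 1) :=
  (integrable_coord c).mul_bdd
    (measurable_dotProduct_resolvent ε E (b := fun x => E k *ᵥ x) continuous_const
      (by fun_prop)).aestronglyMeasurable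
    (ae_of_all _ fun x => abs_dotProduct_resolvent_mulVec_le hε E x k a)

theorem integrable_derivative_term {ε : ℝ} (hε : 0 < ε) (E : K → Matrix ι J ℝ)
    (k : K) (a : ι → ℝ) :
    Integrable (fun x => (a ⬝ᵥ resolvent ε E x *ᵥ a) *
        (1 - E k *ᵥ x ⬝ᵥ resolvent ε E x *ᵥ (E k *ᵥ x)) -
        (a ⬝ᵥ resolvent ε E x *ᵥ (E k *ᵥ x)) ^ 2) (Measure.pi fun _ => gaussianReal 0 1) := by
  have m1 := measurable_dotProduct_resolvent ε E (a := fun _ => a) (b := fun _ => a)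
    continuous_const continuous_const
  have m2 := measurable_dotProduct_resolvent ε E (a := fun x => E k *ᵥ x) (b := fun x => E k *ᵥ x)
    (by fun_prop) (by fun_prop)
  have m3 := measurable_dotProduct_resolvent ε E (a := fun _ => a) (b := fun x => E k *ᵥ x)
    continuous_const (by fun_prop)
  refine integrable_of_measurable_of_abs_le ((m1.mul (m2.const_sub 1)).sub (m3.pow_const 2))
    ((ε⁻¹ * (a ⬝ᵥ a) + ε⁻¹ * (a ⬝ᵥ a)) * (1 + Fintype.card ι) +
      (ε⁻¹ * (a ⬝ᵥ a) + Fintype.card ι) ^ 2) fun x => ?_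
  refine (abs_sub _ _).trans (add_le_add ?_ ?_)
  · rw [abs_mul]
    gcongr
    · exact (abs_nonneg _).trans (abs_dotProduct_resolvent_le hε E x a a)
    · exact abs_dotProduct_resolvent_le hε E x a a
    · rw [abs_le]
      have h1 := dotProduct_resolvent_nonneg hε E x (E k *ᵥ x)
      have h2 := dotProduct_resolvent_self_le_card hε E x k
      constructor <;> linarith
  · rw [abs_pow]
    gcongr
    exact abs_dotProduct_resolvent_mulVec_le hε E x k a

variable [DecidableEq J]

/-- Integration by parts in one coordinate on which, among the vectors `eₖ = Eₖ x`, only a single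
one depends. -/
theorem integral_coord_mul_dotProduct_resolvent {ε : ℝ} (hε : 0 < ε) (E : K → Matrix ι J ℝ)
    (k : K) (c : J) (hc : ∀ k' ≠ k, (E k').col c = 0) :
    ∫ x, x c * ((E k).col c ⬝ᵥ resolvent ε E x *ᵥ (E k *ᵥ x))
        ∂(Measure.pi fun _ => gaussianReal 0 1) =
      ∫ x, ((E k).col c ⬝ᵥ resolvent ε E x *ᵥ (E k).col c) *
        (1 - E k *ᵥ x ⬝ᵥ resolvent ε E x *ᵥ (E k *ᵥ x)) -
        ((E k).col c ⬝ᵥ resolvent ε E x *ᵥ (E k *ᵥ x)) ^ 2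
        ∂(Measure.pi fun _ => gaussianReal 0 1) := by
  classical
  set l := (E k).col c with hl
  refine integral_coord_mul_eq (F := fun x => l ⬝ᵥ resolvent ε E x *ᵥ (E k *ᵥ x)) c
    (integrable_coord_mul_dotProduct_resolvent hε E k c l) (integrable_derivative_term hε E k l)
    fun x => ?_
  set a := E k *ᵥ Function.update x c 0 with ha
  set M₀ := ∑ k' ∈ Finset.univ.erase k,
    vecMulVec (E k' *ᵥ Function.update x c 0) (E k' *ᵥ Function.update x c 0) with hM₀
  have hM₀pos : M₀.PosSemidef := posSemidef_sum _ fun k' _ => posSemidef_vecMulVec_self _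
  -- With the `k`-th term removed, `C` does not depend on coordinate `c`, so varying that coordinate
  -- is a rank-one update of a fixed matrix.
  set C := ε • (1 : Matrix ι ι ℝ) + M₀ with hC
  have hCpos : C.PosDef := posDef_smul_one_add hε hM₀pos
  have hX : ∀ s, E k *ᵥ Function.update x c s = a + s • l := fun s => mulVec_update_eq _ _ _ _
  have hR : ∀ s, resolvent ε E (Function.update x c s) =
      (C + vecMulVec (a + s • l) (a + s • l))⁻¹ := by
    intro s
    rw [resolvent, scatter, ← Finset.sum_erase_add _ _ (Finset.mem_univ k), hX, hC, add_assoc]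
    congr 3
    exact Finset.sum_congr rfl fun k' hk' => by
      rw [mulVec_update_of_col_eq_zero _ _ (hc k' (Finset.ne_of_mem_erase hk'))]
  have hla := dotProduct_mulVec_comm_of_isHermitian hCpos.inv.isHermitian a l
  have hp : ∀ s, l ⬝ᵥ C⁻¹ *ᵥ (a + s • l) = l ⬝ᵥ C⁻¹ *ᵥ a + l ⬝ᵥ C⁻¹ *ᵥ l * s := fun s => by
    rw [mulVec_add, mulVec_smul, dotProduct_add, dotProduct_smul, smul_eq_mul, mul_comm]
  have hq : ∀ s, (a + s • l) ⬝ᵥ C⁻¹ *ᵥ (a + s • l) =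
      a ⬝ᵥ C⁻¹ *ᵥ a + 2 * (l ⬝ᵥ C⁻¹ *ᵥ a) * s + l ⬝ᵥ C⁻¹ *ᵥ l * s ^ 2 := fun s => by
    rw [add_dotProduct, smul_dotProduct, hp, mulVec_add, mulVec_smul, dotProduct_add,
      dotProduct_smul, hla, smul_eq_mul, smul_eq_mul]
    ring
  have hq0 : ∀ s, 0 ≤ a ⬝ᵥ C⁻¹ *ᵥ a + 2 * (l ⬝ᵥ C⁻¹ *ᵥ a) * s + l ⬝ᵥ C⁻¹ *ᵥ l * s ^ 2 := fun s => by
    rw [← hq s]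
    simpa using hCpos.inv.posSemidef.dotProduct_mulVec_nonneg (a + s • l)
  have hnum : ∀ p q : ℝ, 0 ≤ q → p - p * q / (1 + q) = p / (1 + q) := fun p q hq => by
    have : 1 + q ≠ 0 := by positivity
    field_simp
    ring
  have hder : ∀ g p q : ℝ, 0 ≤ q → (g - p * p / (1 + q)) * (1 - q / (1 + q)) -
      (p / (1 + q)) ^ 2 = g / (1 + q) - 2 * p ^ 2 / (1 + q) ^ 2 := fun g p q hq => by
    have : 1 + q ≠ 0 := by positivity
    field_simp
    ring
  simp only [hX, hR, dotProduct_inv_add_vecMulVec_self hCpos, hq, hp, hnum _ _ (hq0 _),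
    hder _ _ _ (hq0 _)]
  exact integral_mul_rational_gaussianReal hq0

/-- Integration by parts in one coordinate on which the vectors `eₖ = Eₖ x` do not depend. -/
theorem integral_coord_mul_dotProduct_resolvent_of_col_eq_zero {ε : ℝ} (hε : 0 < ε)
    (E : K → Matrix ι J ℝ) (Z : Matrix ι J ℝ) (c : J) (hc : ∀ k, (E k).col c = 0) :
    Integrable (fun x => x c * (Z.col c ⬝ᵥ resolvent ε E x *ᵥ (Z *ᵥ x)))
        (Measure.pi fun _ => gaussianReal 0 1) ∧
    ∫ x, x c * (Z.col c ⬝ᵥ resolvent ε E x *ᵥ (Z *ᵥ x))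
        ∂(Measure.pi fun _ => gaussianReal 0 1) =
      ∫ x, Z.col c ⬝ᵥ resolvent ε E x *ᵥ Z.col c ∂(Measure.pi fun _ => gaussianReal 0 1) := by
  have hint : Integrable (fun x => x c * (Z.col c ⬝ᵥ resolvent ε E x *ᵥ (Z *ᵥ x)))
        (Measure.pi fun _ => gaussianReal 0 1) := by
    -- Expanding `Z *ᵥ x` exhibits the integrand as second moments times bounded factors.
    have hsum : (fun x => x c * (Z.col c ⬝ᵥ resolvent ε E x *ᵥ (Z *ᵥ x))) =
        fun x => ∑ c', x c * x c' * (Z.col c ⬝ᵥ resolvent ε E x *ᵥ Z.col c') := by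
      ext x
      rw [mulVec_eq_sum_smul_col Z, mulVec_sum, dotProduct_sum, Finset.mul_sum]
      exact Finset.sum_congr rfl fun c' _ => by
        rw [mulVec_smul, dotProduct_smul, smul_eq_mul, mul_assoc]
    rw [hsum]
    exact integrable_finsetSum _ fun c' _ => (integrable_coord_mul_coord c c').mul_bdd
      (measurable_dotProduct_resolvent ε E continuous_const
        continuous_const).aestronglyMeasurable
      (ae_of_all _ fun x => abs_dotProduct_resolvent_le hε E x _ _)
  refine ⟨hint, ?_⟩
  refine integral_coord_mul_eq (F := fun x => Z.col c ⬝ᵥ resolvent ε E x *ᵥ (Z *ᵥ x)) c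
    hint (integrable_dotProduct_resolvent hε E _ _) fun x => ?_
  obtain ⟨R₀, hR⟩ : ∃ R₀, ∀ s, resolvent ε E (Function.update x c s) = R₀ := by
    refine ⟨resolvent ε E (Function.update x c 0), fun s => ?_⟩
    rw [resolvent, scatter, resolvent, scatter]
    congr 3
    exact funext fun k => by rw [mulVec_update_of_col_eq_zero _ _ (hc k)]
  obtain ⟨z₀, hz⟩ : ∃ z₀, ∀ s, Z *ᵥ Function.update x c s = z₀ + s • Z.col c :=
    ⟨_, mulVec_update_eq Z x c⟩
  simp only [hR, hz, mulVec_add, mulVec_smul, dotProduct_add, dotProduct_smul, smul_eq_mul]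
  rw [integral_mul_affine_gaussianReal]
  simp

end IntegrationByParts

/-! ### Expectation bounds, the limit `ε → 0`, and Markov's inequality. -/

section ExpectationBounds

theorem mulVec_dotProduct_mulVec {ι J : Type*} [Fintype ι] [Fintype J] (L : Matrix ι J ℝ)
    (x : J → ℝ) (b : ι → ℝ) :
    L *ᵥ x ⬝ᵥ b = ∑ c, x c * (L.col c ⬝ᵥ b) := by
  rw [mulVec_eq_sum_smul_col, sum_dotProduct]
  simp only [smul_dotProduct, smul_eq_mul]

variable {ι J K : Type*} [Fintype ι] [DecidableEq ι] [Fintype J] [Fintype K]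

theorem integrable_trace_resolvent_mul {ε : ℝ} (hε : 0 < ε) (E : K → Matrix ι J ℝ)
    (L : Matrix ι J ℝ) :
    Integrable (fun x => (resolvent ε E x * (L * Lᵀ)).trace)
      (Measure.pi fun _ => gaussianReal 0 1) := by
  simp only [← sum_dotProduct_mulVec_col]
  exact integrable_finsetSum _ fun c _ => integrable_dotProduct_resolvent hε E _ _

variable [DecidableEq J]

theorem sum_integral_derivative_term {ε : ℝ} (hε : 0 < ε) (E : K → Matrix ι J ℝ)
    (hdisj : ∀ k k' c, k ≠ k' → (E k).col c = 0 ∨ (E k').col c = 0) :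
    ∫ x, ∑ k, E k *ᵥ x ⬝ᵥ resolvent ε E x *ᵥ (E k *ᵥ x)
        ∂(Measure.pi fun _ => gaussianReal 0 1) =
      ∫ x, ∑ k, ∑ c, (((E k).col c ⬝ᵥ resolvent ε E x *ᵥ (E k).col c) *
        (1 - E k *ᵥ x ⬝ᵥ resolvent ε E x *ᵥ (E k *ᵥ x)) -
        ((E k).col c ⬝ᵥ resolvent ε E x *ᵥ (E k *ᵥ x)) ^ 2)
        ∂(Measure.pi fun _ => gaussianReal 0 1) := by
  have hsum : ∀ x : J → ℝ, ∑ k, E k *ᵥ x ⬝ᵥ resolvent ε E x *ᵥ (E k *ᵥ x) =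
      ∑ k, ∑ c, x c * ((E k).col c ⬝ᵥ resolvent ε E x *ᵥ (E k *ᵥ x)) := fun x =>
    Finset.sum_congr rfl fun k _ => mulVec_dotProduct_mulVec (E k) x _
  simp only [hsum]
  rw [integral_finsetSum _ fun k _ => integrable_finsetSum _ fun c _ =>
      integrable_coord_mul_dotProduct_resolvent hε E k c _,
    integral_finsetSum _ fun k _ => integrable_finsetSum _ fun c _ =>
      integrable_derivative_term hε E k _]
  refine Finset.sum_congr rfl fun k _ => ?_
  rw [integral_finsetSum _ fun c _ => integrable_coord_mul_dotProduct_resolvent hε E k c _,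
    integral_finsetSum _ fun c _ => integrable_derivative_term hε E k _]
  refine Finset.sum_congr rfl fun c _ => ?_
  by_cases h0 : (E k).col c = 0
  · simp [h0]
  · exact integral_coord_mul_dotProduct_resolvent hε E k c fun k' hk' =>
      (hdisj k' k c hk').resolve_right h0

/-- A regularised form of the bound on the mean of an inverse Wishart matrix. -/
theorem integral_trace_resolvent_mul_le {ε : ℝ} (hε : 0 < ε) (E : K → Matrix ι J ℝ)
    (hdisj : ∀ k k' c, k ≠ k' → (E k).col c = 0 ∨ (E k').col c = 0)
    {L : Matrix ι J ℝ} (hS : ∀ k, E k * (E k)ᵀ = L * Lᵀ) :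
    ((Fintype.card K : ℝ) - Fintype.card ι - 1) *
      ∫ x, (resolvent ε E x * (L * Lᵀ)).trace ∂(Measure.pi fun _ => gaussianReal 0 1) ≤
        Fintype.card ι := by
  have hpos : (L * Lᵀ).PosSemidef := by
    simpa using posSemidef_self_mul_conjTranspose L
  have hint : Integrable (fun x => ∑ k, E k *ᵥ x ⬝ᵥ resolvent ε E x *ᵥ (E k *ᵥ x))
      (Measure.pi fun _ : J => gaussianReal 0 1) := by
    refine integrable_finsetSum _ fun k _ => integrable_of_measurable_of_abs_le
      (measurable_dotProduct_resolvent ε E (by fun_prop) (by fun_prop)) (Fintype.card ι)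
      fun x => ?_
    rw [abs_of_nonneg (dotProduct_resolvent_nonneg hε E x _)]
    exact dotProduct_resolvent_self_le_card hε E x k
  calc _ = ∫ x, ((Fintype.card K : ℝ) - Fintype.card ι - 1) *
        (resolvent ε E x * (L * Lᵀ)).trace ∂(Measure.pi fun _ => gaussianReal 0 1) :=
        (integral_const_mul _ _).symm
    _ ≤ ∫ x, ∑ k, ∑ c, (((E k).col c ⬝ᵥ resolvent ε E x *ᵥ (E k).col c) *
        (1 - E k *ᵥ x ⬝ᵥ resolvent ε E x *ᵥ (E k *ᵥ x)) -
        ((E k).col c ⬝ᵥ resolvent ε E x *ᵥ (E k *ᵥ x)) ^ 2)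
        ∂(Measure.pi fun _ => gaussianReal 0 1) := by
      refine integral_mono ((integrable_trace_resolvent_mul hε E L).const_mul _)
        (integrable_finsetSum _ fun k _ => integrable_finsetSum _ fun c _ =>
          integrable_derivative_term hε E k _) fun x => ?_
      -- Pointwise, the integrand is at least `tr(RS) (N - n) - tr(RS)`: `h2` bounds the subtracted
      -- `∑ q_k`, `h1` the squares.
      have h1 := sum_sq_dotProduct_resolvent_le hε E hS hpos x
      have h2 := sum_dotProduct_resolvent_le_card hε E x
      have h3 := trace_mul_nonneg (posDef_resolvent hε E x).posSemidef hpos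
      simp only [Finset.sum_sub_distrib, ← Finset.sum_mul, sum_dotProduct_mulVec_col, hS]
      rw [← Finset.mul_sum, Finset.sum_sub_distrib]
      simp only [Finset.sum_const, Finset.card_univ, nsmul_eq_mul, mul_one]
      nlinarith
    _ = ∫ x, ∑ k, E k *ᵥ x ⬝ᵥ resolvent ε E x *ᵥ (E k *ᵥ x)
        ∂(Measure.pi fun _ => gaussianReal 0 1) := (sum_integral_derivative_term hε E hdisj).symm
    _ ≤ ∫ _, (Fintype.card ι : ℝ) ∂(Measure.pi fun _ : J => gaussianReal 0 1) :=
      integral_mono hint (integrable_const _) fun x => sum_dotProduct_resolvent_le_card hε E x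
    _ = Fintype.card ι := by simp

/-- `Z *ᵥ x` and the resolvent use disjoint sets of Gaussian coordinates, so the former enters only
through its covariance `Z * Zᵀ`. -/
theorem integral_dotProduct_resolvent_of_col_eq_zero {ε : ℝ} (hε : 0 < ε)
    (E : K → Matrix ι J ℝ) (Z : Matrix ι J ℝ) (hZ : ∀ k c, (E k).col c = 0 ∨ Z.col c = 0) :
    Integrable (fun x => Z *ᵥ x ⬝ᵥ resolvent ε E x *ᵥ (Z *ᵥ x))
        (Measure.pi fun _ => gaussianReal 0 1) ∧
      ∫ x, Z *ᵥ x ⬝ᵥ resolvent ε E x *ᵥ (Z *ᵥ x) ∂(Measure.pi fun _ => gaussianReal 0 1) =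
        ∫ x, (resolvent ε E x * (Z * Zᵀ)).trace ∂(Measure.pi fun _ => gaussianReal 0 1) := by
  have key : ∀ c, Integrable (fun x => x c * (Z.col c ⬝ᵥ resolvent ε E x *ᵥ (Z *ᵥ x)))
        (Measure.pi fun _ => gaussianReal 0 1) ∧
      ∫ x, x c * (Z.col c ⬝ᵥ resolvent ε E x *ᵥ (Z *ᵥ x))
        ∂(Measure.pi fun _ => gaussianReal 0 1) =
      ∫ x, Z.col c ⬝ᵥ resolvent ε E x *ᵥ Z.col c ∂(Measure.pi fun _ => gaussianReal 0 1) := by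
    intro c
    by_cases h0 : Z.col c = 0
    · simp [h0]
    · exact integral_coord_mul_dotProduct_resolvent_of_col_eq_zero hε E Z c fun k =>
        (hZ k c).resolve_right h0
  simp only [mulVec_dotProduct_mulVec Z, ← sum_dotProduct_mulVec_col]
  refine ⟨integrable_finsetSum _ fun c _ => (key c).1, ?_⟩
  rw [integral_finsetSum _ fun c _ => (key c).1,
    integral_finsetSum _ fun c _ => integrable_dotProduct_resolvent hε E _ _]
  exact Finset.sum_congr rfl fun c _ => (key c).2

theorem integral_dotProduct_resolvent_le {ε : ℝ} (hε : 0 < ε) (E : K → Matrix ι J ℝ)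
    (hdisj : ∀ k k' c, k ≠ k' → (E k).col c = 0 ∨ (E k').col c = 0)
    {L : Matrix ι J ℝ} (hS : ∀ k, E k * (E k)ᵀ = L * Lᵀ)
    (hcard : Fintype.card ι + 1 < Fintype.card K)
    {Z : Matrix ι J ℝ} (hZ : ∀ k c, (E k).col c = 0 ∨ Z.col c = 0)
    (hZS : (L * Lᵀ - Z * Zᵀ).PosSemidef) :
    ∫ x, Z *ᵥ x ⬝ᵥ resolvent ε E x *ᵥ (Z *ᵥ x) ∂(Measure.pi fun _ => gaussianReal 0 1) ≤
      Fintype.card ι / ((Fintype.card K : ℝ) - Fintype.card ι - 1) := by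
  have hpos : 0 < (Fintype.card K : ℝ) - Fintype.card ι - 1 := by
    have : ((Fintype.card ι + 1 : ℕ) : ℝ) < Fintype.card K := by exact_mod_cast hcard
    push_cast at this
    linarith
  rw [(integral_dotProduct_resolvent_of_col_eq_zero hε E Z hZ).2, le_div_iff₀ hpos, mul_comm]
  refine le_trans ?_ (integral_trace_resolvent_mul_le hε E hdisj hS)
  refine mul_le_mul_of_nonneg_left ?_ hpos.le
  refine integral_mono (integrable_trace_resolvent_mul hε E Z)
    (integrable_trace_resolvent_mul hε E L) fun x => ?_
  have := trace_mul_nonneg (posDef_resolvent hε E x).posSemidef hZS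
  rw [Matrix.mul_sub, trace_sub] at this
  simpa using this

theorem tendsto_dotProduct_inv_mulVec {M : Matrix ι ι ℝ} (hM : M.det ≠ 0) (z : ι → ℝ) :
    Filter.Tendsto
      (fun j : ℕ => z ⬝ᵥ ((1 / ((j : ℝ) + 1)) • (1 : Matrix ι ι ℝ) + M)⁻¹ *ᵥ z) Filter.atTop
      (nhds (z ⬝ᵥ M⁻¹ *ᵥ z)) := by
  have h0 : Filter.Tendsto (fun j : ℕ => (1 / ((j : ℝ) + 1)) • (1 : Matrix ι ι ℝ) + M)
      Filter.atTop (nhds M) := by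
    have := (tendsto_one_div_add_atTop_nhds_zero_nat (𝕜 := ℝ)).smul_const (1 : Matrix ι ι ℝ)
    simpa using this.add_const M
  have hform : ∀ Q : Matrix ι ι ℝ, z ⬝ᵥ Q⁻¹ *ᵥ z = Q.det⁻¹ * (z ⬝ᵥ Q.adjugate *ᵥ z) := fun Q => by
    rw [inv_def, Ring.inverse_eq_inv', smul_mulVec, dotProduct_smul, smul_eq_mul]
  simp only [hform]
  have hdet : Continuous fun Q : Matrix ι ι ℝ => Q.det := continuous_id.matrix_det
  have hadj : Continuous fun Q : Matrix ι ι ℝ => z ⬝ᵥ Q.adjugate *ᵥ z :=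
    continuous_const.dotProduct (continuous_id.matrix_adjugate.matrix_mulVec continuous_const)
  exact (((hdet.tendsto M).comp h0).inv₀ hM).mul ((hadj.tendsto M).comp h0)

/-- Fatou along `ε = 1 / (j + 1)`, the bound for the resolvent being independent of `ε`. Where the
scatter matrix is singular its inverse is `0` by convention and the integrand vanishes. -/
theorem lintegral_dotProduct_inv_scatter_le (E : K → Matrix ι J ℝ)
    (hdisj : ∀ k k' c, k ≠ k' → (E k).col c = 0 ∨ (E k').col c = 0)
    {L : Matrix ι J ℝ} (hS : ∀ k, E k * (E k)ᵀ = L * Lᵀ)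
    (hcard : Fintype.card ι + 1 < Fintype.card K)
    {Z : Matrix ι J ℝ} (hZ : ∀ k c, (E k).col c = 0 ∨ Z.col c = 0)
    (hZS : (L * Lᵀ - Z * Zᵀ).PosSemidef) :
    ∫⁻ x, ENNReal.ofReal (Z *ᵥ x ⬝ᵥ (scatter E x)⁻¹ *ᵥ (Z *ᵥ x))
        ∂(Measure.pi fun _ => gaussianReal 0 1) ≤
      ENNReal.ofReal (Fintype.card ι / ((Fintype.card K : ℝ) - Fintype.card ι - 1)) := by
  have hεj : ∀ j : ℕ, 0 < 1 / ((j : ℝ) + 1) := fun j => by positivity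
  calc _ ≤ ∫⁻ x, Filter.liminf (fun j : ℕ => ENNReal.ofReal
          (Z *ᵥ x ⬝ᵥ resolvent (1 / ((j : ℝ) + 1)) E x *ᵥ (Z *ᵥ x))) Filter.atTop
          ∂(Measure.pi fun _ => gaussianReal 0 1) := by
        refine lintegral_mono fun x => ?_
        by_cases hM : (scatter E x).det = 0
        · have : (scatter E x)⁻¹ = 0 := nonsing_inv_apply_not_isUnit _ (by simp [hM])
          simp [this]
        · exact (ENNReal.tendsto_ofReal
            (tendsto_dotProduct_inv_mulVec hM (Z *ᵥ x))).liminf_eq.ge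
    _ ≤ Filter.liminf (fun j : ℕ => ∫⁻ x, ENNReal.ofReal
          (Z *ᵥ x ⬝ᵥ resolvent (1 / ((j : ℝ) + 1)) E x *ᵥ (Z *ᵥ x))
          ∂(Measure.pi fun _ => gaussianReal 0 1)) Filter.atTop :=
        lintegral_liminf_le fun j => (measurable_dotProduct_resolvent _ E (by fun_prop)
          (by fun_prop)).ennreal_ofReal
    _ ≤ _ := by
        refine Filter.liminf_le_of_frequently_le' (Filter.Frequently.of_forall fun j => ?_)
        rw [← ofReal_integral_eq_lintegral_ofReal
          (integral_dotProduct_resolvent_of_col_eq_zero (hεj j) E Z hZ).1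
          (ae_of_all _ fun x => dotProduct_resolvent_nonneg (hεj j) E x _)]
        exact ENNReal.ofReal_le_ofReal
          (integral_dotProduct_resolvent_le (hεj j) E hdisj hS hcard hZ hZS)

theorem measure_lt_dotProduct_inv_scatter_le (E : K → Matrix ι J ℝ)
    (hdisj : ∀ k k' c, k ≠ k' → (E k).col c = 0 ∨ (E k').col c = 0)
    {L : Matrix ι J ℝ} (hS : ∀ k, E k * (E k)ᵀ = L * Lᵀ)
    (hcard : Fintype.card ι + 1 < Fintype.card K)
    {Z : Matrix ι J ℝ} (hZ : ∀ k c, (E k).col c = 0 ∨ Z.col c = 0)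
    (hZS : (L * Lᵀ - Z * Zᵀ).PosSemidef) {r : ℝ} (hr : 0 < r) :
    (Measure.pi fun _ => gaussianReal 0 1)
        {x | r < Z *ᵥ x ⬝ᵥ (scatter E x)⁻¹ *ᵥ (Z *ᵥ x)} ≤
      ENNReal.ofReal (Fintype.card ι / ((Fintype.card K : ℝ) - Fintype.card ι - 1) / r) := by
  have hm : Measurable fun x => ENNReal.ofReal (Z *ᵥ x ⬝ᵥ (scatter E x)⁻¹ *ᵥ (Z *ᵥ x)) :=
    (measurable_dotProduct_inv_mulVec (continuous_scatter E) (by fun_prop)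
      (by fun_prop)).ennreal_ofReal
  rw [ENNReal.ofReal_div_of_pos hr]
  refine le_trans (measure_mono fun x hx => ?_) ((meas_ge_le_lintegral_div hm.aemeasurable
    (ε := ENNReal.ofReal r) (by simpa using hr) (by simp)).trans ?_)
  · exact ENNReal.ofReal_le_ofReal (le_of_lt hx)
  · gcongr
    exact lintegral_dotProduct_inv_scatter_le E hdisj hS hcard hZ hZS

end ExpectationBounds

/-! ### Bookkeeping for linear maps on a family of noise blocks. -/

section BlockRow

variable {ι κ I : Type*} [Fintype κ] [Fintype I]

/-- The matrix whose columns are those of all the matrices of a family. -/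
def blockRow (G : I → Matrix ι κ ℝ) : Matrix ι (I × κ) ℝ :=
  Matrix.of fun a c => G c.1 a c.2

theorem blockRow_mulVec (G : I → Matrix ι κ ℝ) (g : I × κ → ℝ) :
    blockRow G *ᵥ g = ∑ i, G i *ᵥ fun j => g (i, j) := by
  ext a
  simp [blockRow, mulVec, dotProduct, Finset.sum_apply, Fintype.sum_prod_type]

theorem blockRow_mul_transpose (G : I → Matrix ι κ ℝ) :
    blockRow G * (blockRow G)ᵀ = ∑ i, G i * (G i)ᵀ := by
  ext a b
  simp [blockRow, mul_apply, Matrix.sum_apply, Fintype.sum_prod_type]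

theorem blockRow_col_eq_zero {ι κ I : Type*} {G : I → Matrix ι κ ℝ} {i : I} (h : G i = 0) (j : κ) :
    (blockRow G).col (i, j) = 0 := by
  ext a
  simp [blockRow, h]

end BlockRow

section SparseSums

variable {I α β : Type*} [Fintype I] [DecidableEq I] [Zero α] [AddCommMonoid β]

theorem sum_apply_ite_eq (F : I → α → β) (hF : ∀ i, F i 0 = 0) (a : I) (U : α) :
    ∑ i, F i (if i = a then U else 0) = F a U := by
  rw [Fintype.sum_eq_single a fun i hi => by rw [if_neg hi, hF], if_pos rfl]

theorem sum_apply_ite_ite_eq (F : I → α → β) (hF : ∀ i, F i 0 = 0) {a b : I} (hab : a ≠ b)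
    (U V : α) :
    ∑ i, F i (if i = a then U else if i = b then V else 0) = F a U + F b V := by
  rw [Fintype.sum_eq_add a b hab fun i hi => by rw [if_neg hi.1, if_neg hi.2, hF], if_pos rfl,
    if_neg hab.symm, if_pos rfl]

end SparseSums

/-! ### Representing the noise by independent standard Gaussians. -/

section Law

variable {Ω : Type*} [MeasurableSpace Ω] {P : Measure Ω}

open scoped MatrixOrder in
/-- A centred Gaussian vector with covariance `S` is distributed as a linear image, by a matrix `L`
with `L Lᵀ = S`, of a vector of independent standard Gaussian variables. -/
theorem exists_factor_of_multivariateGaussian {ι : Type*} [Fintype ι] [DecidableEq ι]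
    {S : Matrix ι ι ℝ} (hS : S.PosSemidef) (P : Measure Ω) :
    ∃ L : Matrix ι ι ℝ, L * Lᵀ = S ∧ ∀ X : Ω → ι → ℝ,
      HasLaw (fun ω => WithLp.toLp 2 (X ω)) (multivariateGaussian 0 S) P →
      AEMeasurable X P ∧
        P.map X = (Measure.pi fun _ : ι => gaussianReal 0 1).map fun g => L *ᵥ g := by
  have hT : (CFC.sqrt S)ᵀ = CFC.sqrt S := by
    have := (CFC.sqrt_nonneg S).isSelfAdjoint.star_eq
    rwa [star_eq_conjTranspose, conjTranspose_eq_transpose_of_trivial] at this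
  -- The symmetric square root exists for singular `S` too; chosen before `X`, it serves all time
  -- indices at once.
  refine ⟨CFC.sqrt S, by rw [hT, CFC.sqrt_mul_sqrt_self _ hS.nonneg], fun X hX => ?_⟩
  have hofLp : Measurable (WithLp.ofLp : EuclideanSpace ℝ ι → ι → ℝ) :=
    (PiLp.continuous_ofLp 2 _).measurable
  refine ⟨hofLp.comp_aemeasurable hX.aemeasurable, ?_⟩
  have h1 : P.map X = (P.map fun ω => WithLp.toLp 2 (X ω)).map WithLp.ofLp := by
    rw [AEMeasurable.map_map_of_aemeasurable hofLp.aemeasurable hX.aemeasurable]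
    rfl
  rw [h1, hX.map_eq, multivariateGaussian, ← map_pi_eq_stdGaussian,
    Measure.map_map (by fun_prop) (by fun_prop), Measure.map_map (by fun_prop) (by fun_prop)]
  congr 1
  ext g i
  simp

theorem map_pi_of_iIndepFun [IsProbabilityMeasure P] {I κ : Type*} [Fintype I] [Fintype κ]
    {X : I → Ω → κ → ℝ} {L : I → Matrix κ κ ℝ} (hindep : iIndepFun X P)
    (hm : ∀ i, AEMeasurable (X i) P)
    (hlaw : ∀ i, P.map (X i) = (Measure.pi fun _ : κ => gaussianReal 0 1).map fun g => L i *ᵥ g) :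
    P.map (fun ω i => X i ω) =
      (Measure.pi fun _ : I × κ => gaussianReal 0 1).map
        fun g i => L i *ᵥ fun j => g (i, j) := by
  rw [(iIndepFun_iff_map_fun_eq_pi_map hm).1 hindep]
  simp only [hlaw]
  have hcurry := Measure.infinitePi_map_curry (ι := I) (κ := κ) (X := ℝ)
    (μ := fun _ _ => gaussianReal 0 1)
  simp only [Measure.infinitePi_eq_pi] at hcurry
  have hL : ∀ i, Measurable fun g : κ → ℝ => L i *ᵥ g := fun i =>
    (Continuous.matrix_mulVec continuous_const continuous_id).measurable
  have hL' : Measurable fun (g : I → κ → ℝ) i => L i *ᵥ g i :=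
    measurable_pi_lambda _ fun i => (hL i).comp (measurable_pi_apply i)
  rw [← Measure.pi_map_pi fun i => (hL i).aemeasurable, ← hcurry,
    Measure.map_map hL' (MeasurableEquiv.measurable _)]
  rfl

end Law

/-! ### The prediction error against the empirical ellipsoid. -/

theorem inv_smul_of_ne_zero {ι : Type*} [Fintype ι] [DecidableEq ι] {c : ℝ} (hc : c ≠ 0)
    (M : Matrix ι ι ℝ) : (c • M)⁻¹ = c⁻¹ • M⁻¹ := by
  by_cases hM : IsUnit M.det
  · exact inv_smul' M (Units.mk0 c hc) hM
  · rw [nonsing_inv_apply_not_isUnit _ hM, smul_zero, nonsing_inv_apply_not_isUnit]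
    rw [det_smul]
    simp only [isUnit_iff_ne_zero, not_not] at hM ⊢
    simp [hM]

theorem measure_prediction_error_gt_le {Ω : Type*} [MeasurableSpace Ω] {P : Measure Ω}
    [IsProbabilityMeasure P] {n : ℕ} (A Sw Sv : Matrix (Fin n) (Fin n) ℝ)
    (hSw : Sw.PosSemidef) (hSv : Sv.PosSemidef) (w v : ℕ → Ω → Fin n → ℝ)
    (hw : ∀ k, HasLaw (fun ω => WithLp.toLp 2 (w k ω)) (multivariateGaussian 0 Sw) P)
    (hv : ∀ k, HasLaw (fun ω => WithLp.toLp 2 (v k ω)) (multivariateGaussian 0 Sv) P)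
    (hindep : iIndepFun (Sum.elim w v) P) {t : ℕ} (ht : 2 * n + 3 < t) {r : ℝ} (hr : 0 < r) :
    P {ω | r < (w t ω - A *ᵥ v t ω) ⬝ᵥ
        (∑ k : Fin (t / 2), vecMulVec (w (2 * k) ω + v (2 * k + 1) ω - A *ᵥ v (2 * k) ω)
          (w (2 * k) ω + v (2 * k + 1) ω - A *ᵥ v (2 * k) ω))⁻¹ *ᵥ (w t ω - A *ᵥ v t ω)} ≤
      ENNReal.ofReal (n / (((t / 2 : ℕ) : ℝ) - n - 1) / r) := by
  obtain ⟨Lw, hLw, hlaw_w⟩ := exists_factor_of_multivariateGaussian hSw P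
  obtain ⟨Lv, hLv, hlaw_v⟩ := exists_factor_of_multivariateGaussian hSv P
  let L : Fin (t + 1) ⊕ Fin (t + 1) → Matrix (Fin n) (Fin n) ℝ := Sum.elim (fun _ => Lw) fun _ => Lv
  let idx : Fin (t + 1) ⊕ Fin (t + 1) → ℕ ⊕ ℕ := Sum.map Fin.val Fin.val
  have hidx : idx.Injective := Function.Injective.sumMap Fin.val_injective Fin.val_injective
  let even : Fin (t / 2) → Fin (t + 1) := fun k => ⟨2 * k, by omega⟩
  let odd : Fin (t / 2) → Fin (t + 1) := fun k => ⟨2 * k + 1, by omega⟩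
  have hmap := map_pi_of_iIndepFun (L := L) (hindep.precomp hidx)
    (by
      rintro (i | i)
      · exact (hlaw_w _ (hw i)).1
      · exact (hlaw_v _ (hv i)).1)
    (by
      rintro (i | i)
      · exact (hlaw_w _ (hw i)).2
      · exact (hlaw_v _ (hv i)).2)
  have hmeas : AEMeasurable (fun ω i => Sum.elim w v (idx i) ω) P := by
    refine aemeasurable_pi_lambda _ ?_
    rintro (i | i)
    · exact (hlaw_w _ (hw i)).1
    · exact (hlaw_v _ (hv i)).1
  let e : Fin (t / 2) → (Fin (t + 1) ⊕ Fin (t + 1) → Fin n → ℝ) → Fin n → ℝ := fun k ξ =>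
    ξ (Sum.inl (even k)) + ξ (Sum.inr (odd k)) - A *ᵥ ξ (Sum.inr (even k))
  let z : (Fin (t + 1) ⊕ Fin (t + 1) → Fin n → ℝ) → Fin n → ℝ := fun ξ =>
    ξ (Sum.inl (Fin.last t)) - A *ᵥ ξ (Sum.inr (Fin.last t))
  have he : ∀ k, Continuous (e k) := fun k => by fun_prop
  have hz : Continuous z := by fun_prop
  let bad : Set (Fin (t + 1) ⊕ Fin (t + 1) → Fin n → ℝ) :=
    {ξ | r < z ξ ⬝ᵥ (∑ k, vecMulVec (e k ξ) (e k ξ))⁻¹ *ᵥ z ξ}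
  have hbad : MeasurableSet bad :=
    measurableSet_lt measurable_const (measurable_dotProduct_inv_mulVec
      (continuous_finsetSum _ fun k _ => (he k).matrix_vecMulVec (he k)) hz hz)
  -- `E k` and `Z` express `e_k` and `z` through the standard Gaussian coordinates; nonzero blocks
  -- record which noises occur.
  let E : Fin (t / 2) → Matrix (Fin n) ((Fin (t + 1) ⊕ Fin (t + 1)) × Fin n) ℝ := fun k =>
    blockRow (Sum.elim
    (fun i => if i = even k then Lw else 0)
    (fun i => if i = odd k then Lv else if i = even k then -(A * Lv) else 0))
  let Z : Matrix (Fin n) ((Fin (t + 1) ⊕ Fin (t + 1)) × Fin n) ℝ := blockRow (Sum.elim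
    (fun i => if i = Fin.last t then Lw else 0)
    (fun i => if i = Fin.last t then -(A * Lv) else 0))
  have hne : ∀ k, odd k ≠ even k := fun k h => by
    have := congrArg Fin.val h
    simp only [odd, even] at this
    omega
  have hE : ∀ k g, E k *ᵥ g = e k fun i => L i *ᵥ fun j => g (i, j) := by
    intro k g
    simp only [E, blockRow_mulVec, Fintype.sum_sum_type, Sum.elim_inl, Sum.elim_inr]
    rw [sum_apply_ite_eq (fun i M => M *ᵥ fun j => g (Sum.inl i, j)) (by simp),
      sum_apply_ite_ite_eq (fun i M => M *ᵥ fun j => g (Sum.inr i, j)) (by simp) (hne k)]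
    simp only [e, L, Sum.elim_inl, Sum.elim_inr, neg_mulVec, mulVec_mulVec]
    abel
  have hZ : ∀ g, Z *ᵥ g = z fun i => L i *ᵥ fun j => g (i, j) := by
    intro g
    simp only [Z, blockRow_mulVec, Fintype.sum_sum_type, Sum.elim_inl, Sum.elim_inr]
    rw [sum_apply_ite_eq (fun i M => M *ᵥ fun j => g (Sum.inl i, j)) (by simp),
      sum_apply_ite_eq (fun i M => M *ᵥ fun j => g (Sum.inr i, j)) (by simp)]
    simp only [z, L, Sum.elim_inl, Sum.elim_inr, neg_mulVec, mulVec_mulVec]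
    abel
  have hEE : ∀ k, E k * (E k)ᵀ = Sw + (Sv + A * Lv * (A * Lv)ᵀ) := by
    intro k
    simp only [E, blockRow_mul_transpose, Fintype.sum_sum_type, Sum.elim_inl, Sum.elim_inr]
    rw [sum_apply_ite_eq (fun _ M => M * Mᵀ) (by simp),
      sum_apply_ite_ite_eq (fun _ M => M * Mᵀ) (by simp) (hne k), hLw,
      hLv, transpose_neg, neg_mul_neg]
  have hZZ : Z * Zᵀ = Sw + A * Lv * (A * Lv)ᵀ := by
    simp only [Z, blockRow_mul_transpose, Fintype.sum_sum_type, Sum.elim_inl, Sum.elim_inr]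
    rw [sum_apply_ite_eq (fun _ M => M * Mᵀ) (by simp),
      sum_apply_ite_eq (fun _ M => M * Mᵀ) (by simp), hLw,
      transpose_neg, neg_mul_neg]
  have hdisj : ∀ k k' c, k ≠ k' → (E k).col c = 0 ∨ (E k').col c = 0 := by
    rintro k k' ⟨i | i, j⟩ hk
    · by_cases hi : i = even k
      · right
        refine blockRow_col_eq_zero ?_ j
        have : i ≠ even k' := by simp only [even, Fin.ext_iff, ne_eq] at *; omega
        simp [this]
      · left
        exact blockRow_col_eq_zero (by simp [hi]) j
    · by_cases hi : i = even k ∨ i = odd k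
      · right
        refine blockRow_col_eq_zero ?_ j
        have h1 : i ≠ even k' := by simp only [even, odd, Fin.ext_iff, ne_eq] at *; omega
        have h2 : i ≠ odd k' := by simp only [even, odd, Fin.ext_iff, ne_eq] at *; omega
        simp [h1, h2]
      · left
        rw [not_or] at hi
        exact blockRow_col_eq_zero (by simp [hi.1, hi.2]) j
  have hdisjZ : ∀ k c, (E k).col c = 0 ∨ Z.col c = 0 := by
    rintro k ⟨i | i, j⟩
    · by_cases hi : i = Fin.last t
      · left
        refine blockRow_col_eq_zero ?_ j
        have : i ≠ even k := by
          simp only [even, Fin.ext_iff, ne_eq, Fin.val_last] at *; omega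
        simp [this]
      · right
        exact blockRow_col_eq_zero (by simp [hi]) j
    · by_cases hi : i = Fin.last t
      · left
        refine blockRow_col_eq_zero ?_ j
        have h1 : i ≠ even k := by
          simp only [even, Fin.ext_iff, ne_eq, Fin.val_last] at *; omega
        have h2 : i ≠ odd k := by
          simp only [odd, Fin.ext_iff, ne_eq, Fin.val_last] at *; omega
        simp [h1, h2]
      · right
        exact blockRow_col_eq_zero (by simp [hi]) j
  have hk₀ : 0 < t / 2 := by omega
  -- Any factor of the common covariance would serve as `L`; the first block row is at hand.
  have hmain := measure_lt_dotProduct_inv_scatter_le E hdisj (L := E ⟨0, hk₀⟩)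
    (fun k => by rw [hEE, hEE]) (by simp only [Fintype.card_fin]; omega) (Z := Z) hdisjZ
    (by
      -- The covariances differ by exactly `Sv`: each residual carries the noise of the later
      -- measurement, `z` does not.
      have : Sw + (Sv + A * Lv * (A * Lv)ᵀ) - (Sw + A * Lv * (A * Lv)ᵀ) = Sv := by abel
      rwa [hEE, hZZ, this]) hr
  simp only [Fintype.card_fin] at hmain
  refine le_trans (le_of_eq ?_) hmain
  have hL : Measurable fun (g : (Fin (t + 1) ⊕ Fin (t + 1)) × Fin n → ℝ) i => L i *ᵥ
      fun j => g (i, j) := by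
    refine Continuous.measurable ?_
    fun_prop
  have h1 := Measure.map_apply_of_aemeasurable hmeas hbad
  rw [hmap, Measure.map_apply hL hbad] at h1
  refine h1.symm.trans ?_
  congr 1
  ext g
  simp only [bad, Set.mem_preimage, Set.mem_ofPred_eq, scatter, hE, hZ]

end NoisySafeLearning

/-! ### The safety guarantee. -/

theorem theorem5 {Ω : Type*} [MeasurableSpace Ω] (P : MeasureTheory.Measure Ω)
    [MeasureTheory.IsProbabilityMeasure P]
    {n m p : ℕ}
    -- linear dynamics and covariances of the process and measurement noise
    (A : Matrix (Fin n) (Fin n) ℝ) (B : Matrix (Fin n) (Fin m) ℝ)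
    (Sw Sv : Matrix (Fin n) (Fin n) ℝ) (hSw : Sw.PosSemidef) (hSv : Sv.PosSemidef)
    -- process noise `w` and measurement noise `v`: Gaussian, all mutually independent
    (w v : ℕ → Ω → Fin n → ℝ)
    (hw : ∀ k, ProbabilityTheory.HasLaw (fun ω => WithLp.toLp 2 (w k ω))
      (ProbabilityTheory.multivariateGaussian 0 Sw) P)
    (hv : ∀ k, ProbabilityTheory.HasLaw (fun ω => WithLp.toLp 2 (v k ω))
      (ProbabilityTheory.multivariateGaussian 0 Sv) P)
    (hindep : ProbabilityTheory.iIndepFun (Sum.elim w v) P)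
    -- states `x`, measurements `y`, inputs `u`
    (x y : ℕ → Ω → Fin n → ℝ) (u : ℕ → Ω → Fin m → ℝ)
    (hx : ∀ k ω, x (k + 1) ω = A *ᵥ x k ω + B *ᵥ u k ω + w k ω)
    (hy : ∀ k ω, y k ω = x k ω + v k ω)
    -- safety constraints `H k *ᵥ x k ≤ h k`
    (H : ℕ → Matrix (Fin p) (Fin n) ℝ) (h : ℕ → Fin p → ℝ)
    -- objective `d(·, ubar)` of the robust program, with nominal inputs `ubar`
    (d : (Fin m → ℝ) → (Fin m → ℝ) → ℝ) (ubar : ℕ → Ω → Fin m → ℝ)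
    (δ : ℝ) (hδ : 0 < δ) (t : ℕ) (ht : 2 * n + 3 < t)
    -- feasible set at time `t` of the robust program
    (F : Ω → Set (Fin m → ℝ))
    (hF : ∀ ω, F ω = NoisySafeLearning.feasibleSet A B (H (t + 1)) (h (t + 1)) (y t ω)
      (NoisySafeLearning.empiricalCov A B (fun k => y k ω) (fun k => u k ω) t)
      (NoisySafeLearning.ellipsoidBound n t δ))
    -- whenever the program is feasible, the implemented input `u t` is a solution of it
    (hu : ∀ᵐ ω ∂P, (F ω).Nonempty → NoisySafeLearning.IsArgmin d (ubar t ω) (F ω) (u t ω)) :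
    ((∀ᵐ ω ∂P, (F ω).Nonempty) →
      1 - δ ≤ P.real {ω | H (t + 1) *ᵥ x (t + 1) ω ≤ h (t + 1)}) ∧
    1 - δ ≤ P.real {ω | (F ω).Nonempty → H (t + 1) *ᵥ x (t + 1) ω ≤ h (t + 1)} := by
  have hN : n + 2 ≤ t / 2 := by omega
  have hNR : ((n : ℝ) + 2) ≤ ((t / 2 : ℕ) : ℝ) := by exact_mod_cast hN
  set N : ℝ := ((t / 2 : ℕ) : ℝ) with hNdef
  have hn0 : (0 : ℝ) ≤ n := Nat.cast_nonneg n
  have hNpos : 0 < N := by linarith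
  have hgap : 0 < N - n - 1 := by linarith
  let M : Ω → Matrix (Fin n) (Fin n) ℝ := fun ω => ∑ k : Fin (t / 2),
    Matrix.vecMulVec (w (2 * k) ω + v (2 * k + 1) ω - A *ᵥ v (2 * k) ω)
      (w (2 * k) ω + v (2 * k + 1) ω - A *ᵥ v (2 * k) ω)
  let z : Ω → Fin n → ℝ := fun ω => w t ω - A *ᵥ v t ω
  have herr : ∀ k ω, y (k + 1) ω - (A *ᵥ y k ω + B *ᵥ u k ω) =
      w k ω + v (k + 1) ω - A *ᵥ v k ω := fun k ω => by
    rw [hy, hy, hx, Matrix.mulVec_add]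
    abel
  have hcov : ∀ ω, NoisySafeLearning.empiricalCov A B (fun k => y k ω) (fun k => u k ω) t =
      N⁻¹ • M ω := fun ω => by
    simp only [NoisySafeLearning.empiricalCov, herr, M, Finset.sum_range]
    rfl
  have hnext : ∀ ω, x (t + 1) ω = A *ᵥ y t ω + B *ᵥ u t ω + z ω := fun ω => by
    simp only [z]
    rw [hx, hy, Matrix.mulVec_add]
    abel
  set c := NoisySafeLearning.ellipsoidBound n t δ with hc
  -- If `M ω` is singular the form is `0 ≤ c`, so `ω` is not bad, consistently with the constraint
  -- then ranging over all of `ℝⁿ`.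
  let bad : Set Ω := {ω | c < z ω ⬝ᵥ ((N⁻¹ • M ω)⁻¹ *ᵥ z ω)}
  have hbad : P.real bad ≤ δ := by
    -- For `n = 0` the Markov threshold would be `0`, but both sides defining `bad` vanish.
    rcases Nat.eq_zero_or_pos n with rfl | hn
    · have : bad = ∅ := by
        ext ω
        simp [bad, hc, NoisySafeLearning.ellipsoidBound]
      simp [this, hδ.le]
    · have hnR : (0 : ℝ) < n := Nat.cast_pos.2 hn
      -- This threshold makes the Markov bound exactly `δ`; the factor `N` in `c` is absorbed by
      -- `(N⁻¹ • M)⁻¹ = N • M⁻¹`.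
      have hr : 0 < n / ((N - n - 1) * δ) := by positivity
      have hle := NoisySafeLearning.measure_prediction_error_gt_le A Sw Sv hSw hSv w v hw hv
        hindep ht hr
      rw [← hNdef] at hle
      have hval : n / (N - n - 1) / (n / ((N - n - 1) * δ)) = δ := by
        field_simp
      rw [hval] at hle
      refine ENNReal.toReal_le_of_le_ofReal hδ.le (le_trans (MeasureTheory.measure_mono ?_) hle)
      intro ω hω
      simp only [bad, Set.mem_ofPred_eq, NoisySafeLearning.inv_smul_of_ne_zero
        (inv_ne_zero hNpos.ne'), inv_inv, Matrix.smul_mulVec, dotProduct_smul, smul_eq_mul] at hω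
      have hcN : c = N * (n / ((N - n - 1) * δ)) := by
        rw [hc, NoisySafeLearning.ellipsoidBound, ← hNdef, mul_div_assoc]
      rw [hcN] at hω
      exact lt_of_mul_lt_mul_left hω hNpos.le
  have hsafe : ∀ ω, ((F ω).Nonempty → NoisySafeLearning.IsArgmin d (ubar t ω) (F ω) (u t ω)) →
      ω ∉ bad → (F ω).Nonempty → H (t + 1) *ᵥ x (t + 1) ω ≤ h (t + 1) := by
    intro ω hω hgood hne
    have hmem := (hω hne).1
    rw [hF, hcov] at hmem
    rw [hnext]
    exact hmem (z ω) (not_lt.1 hgood)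
  -- Only monotonicity and subadditivity are used, so `T` need not be measurable; nothing is assumed
  -- on the measurability of `u` or `x`.
  have hprob : ∀ T : Set Ω, (∀ᵐ ω ∂P, ω ∉ bad → ω ∈ T) → 1 - δ ≤ P.real T := by
    intro T hT
    have h1 : P.real Set.univ ≤ P.real (bad ∪ T) := by
      refine ENNReal.toReal_mono (MeasureTheory.measure_ne_top _ _)
        (MeasureTheory.measure_mono_ae ?_)
      filter_upwards [hT] with ω hω _
      exact or_iff_not_imp_left.2 hω
    rw [MeasureTheory.probReal_univ] at h1
    linarith [MeasureTheory.measureReal_union_le (μ := P) bad T]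
  refine ⟨fun hfeas => hprob _ ?_, hprob _ ?_⟩
  · filter_upwards [hu, hfeas] with ω hω hne hgood
    exact hsafe ω hω hgood hne
  · filter_upwards [hu] with ω hω hgood
    exact hsafe ω hω hgood
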